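/- Let $C>0$, $0<\alpha<1$ and $R>0$. Let $\Gamma=\{x+iy\in\mathbb{C} : x>C|y|^{\alpha}\}$ be the planar cusp with vertex at the origin, let $\Delta_R=\{z\in\mathbb{C} : |z|<R\}$, and put $$a=\frac R2,\qquad A=\frac{\pi\,C^{1/\alpha}}{2\,(1/\alpha-1)}.$$ For a domain $\Omega\subset\mathbb{C}$ and $p\in\Omega$, the negative Green function of $\Omega$ with pole $p$ is $$g_\Omega(z,p)=\sup\{\varphi(z) : \varphi \text{ is a negative subharmonic function on } \Omega \text{ with } \varphi(w)-\log|w-p|=O(1) \text{ as } w\to p\},$$ where subharmonic functions are upper semicontinuous with values in $[-\infty,\infty)$ and satisfy the local submean value inequality. Then there are constants $c_1,c_2,t_0>0$, depending only on $C$, $\alpha$ and $R$, such that for all $0<t<t_0$ $$-c_2\exp\left(-\frac{A}{t^{1/\alpha-1}}\right)\le g_{\Gamma\cap\Delta_R}(t,a)\le -c_1\exp\left(-\frac{A}{t^{1/\alpha-1}}\right).$$ -/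

import Mathlib

open MeasureTheory Topology Filter

noncomputable section

/-- The mean value `(1/2π) ∫₀^{2π} u (c + r e^{iθ}) dθ ∈ [-∞, ∞]` of an extended-real-valued
function, the integral being (integral of the positive part) minus (integral of the negative
part). For `u` upper semicontinuous and `< ∞` on the circle the first integral is finite. -/
def circleMean (u : ℂ → EReal) (c : ℂ) (r : ℝ) : EReal :=
  (((2 * Real.pi)⁻¹ : ℝ) : EReal) *
    (((∫⁻ θ in Set.Ioc 0 (2 * Real.pi), (u (circleMap c r θ)).toENNReal : ENNReal) : EReal) -
      ((∫⁻ θ in Set.Ioc 0 (2 * Real.pi), (-u (circleMap c r θ)).toENNReal : ENNReal) : EReal))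

/-- `u : Ω → [-∞, ∞)` is subharmonic on the open set `Ω ⊆ ℂ`: it is upper semicontinuous and
satisfies the local submean inequality. Only the values of `u` on `Ω` matter. -/
structure IsSubharmonicOn (u : ℂ → EReal) (Ω : Set ℂ) : Prop where
  usc : UpperSemicontinuousOn u Ω
  lt_top : ∀ z ∈ Ω, u z < ⊤
  submean : ∀ z ∈ Ω, ∃ ρ : ℝ, 0 < ρ ∧ Metric.ball z ρ ⊆ Ω ∧
    ∀ r : ℝ, 0 < r → r < ρ → u z ≤ circleMean u z r

/-- The negative subharmonic functions `φ` on `Ω` such that `φ(z) - log |z - a| = O(1)` as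
`z → a`. -/
def greenFamily (Ω : Set ℂ) (a : ℂ) : Set (ℂ → EReal) :=
  {φ | IsSubharmonicOn φ Ω ∧ (∀ z ∈ Ω, φ z < 0) ∧
    ∃ M : ℝ, ∀ᶠ z in 𝓝[≠] a,
      ((Real.log ‖z - a‖ - M : ℝ) : EReal) ≤ φ z ∧ φ z ≤ ((Real.log ‖z - a‖ + M : ℝ) : EReal)}

/-- The (negative) Green function `g_Ω(z, a)` of `Ω` with pole `a`: the upper envelope of
`greenFamily Ω a`. -/
def greenFunction (Ω : Set ℂ) (z a : ℂ) : EReal :=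
  ⨆ φ ∈ greenFamily Ω a, φ z

/-- The planar cusp `{x + iy : x > C |y|^α}`, with vertex at the origin. -/
def planarCusp (C α : ℝ) : Set ℂ :=
  {z | C * |z.im| ^ α < z.re}

/-- The constant `A = π C^{1/α} / (2 (1/α - 1))`. -/
def cuspConst (C α : ℝ) : ℝ :=
  Real.pi * C ^ (1 / α) / (2 * (1 / α - 1))

end

/-! Put `b = 1/α - 1`. Near the vertex the edge of the cusp has argument about `±r^b / C^(b+1)`, so
`w = z^(-b)` has imaginary part about `∓b / C^(b+1)` there: the cusp becomes nearly a half-strip of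
half-width `π / (2A)`. The positive harmonic function on that half-strip vanishing on its sides and
at infinity is `Re exp (-A w)`, equal to `exp (-A / t^b)` at `t`. Both bounds compare the Green
function with it; the error in "nearly" is controlled to within constant factors.

Lower bound: `z^(-b)` maps the whole cusp into the strip exactly, so `h = Re exp (-A w)` is
positive, and gluing `log (|z - a| / T)` near the pole to its maximum with `-c h` elsewhere gives a
competitor (`exists_neg_mul_le_greenFunction`).

Upper bound: with `w = z^(-b) - c z^b` and a suitable `c > 0`, the edge near the vertex falls
strictly outside the strip (`exists_cuspMap_boundary`). The preimage of the strip then meets the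
edge only at the vertex, and the barrier vanishes on its sides. On the remaining arc all competitors
lie below one constant `-m` (`exists_le_neg_of_mem_greenFamily`), so the maximum principle
(`IsSubharmonicOn.le_of_frontier`) puts each of them below `-m` times the barrier. -/

/-! ### Circle means and the maximum principle -/

theorem circleMean_mono {u v : ℂ → EReal} {c : ℂ} {r : ℝ}
    (h : ∀ z ∈ Metric.sphere c |r|, u z ≤ v z) : circleMean u c r ≤ circleMean v c r := by
  unfold circleMean
  have hm : ∀ θ : ℝ, circleMap c r θ ∈ Metric.sphere c |r| := circleMap_mem_sphere' c r
  refine mul_le_mul_of_nonneg_left (EReal.sub_le_sub ?_ ?_)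
    (by exact_mod_cast (inv_nonneg.2 Real.two_pi_pos.le))
  · exact_mod_cast lintegral_mono fun θ => EReal.toENNReal_le_toENNReal (h _ (hm θ))
  · exact_mod_cast lintegral_mono fun θ =>
      EReal.toENNReal_le_toENNReal (EReal.neg_le_neg_iff.2 (h _ (hm θ)))

theorem circleMean_coe {f : ℂ → ℝ} {c : ℂ} {r : ℝ}
    (hf : ContinuousOn f (Metric.sphere c |r|)) :
    circleMean (fun z => (f z : EReal)) c r = ((Real.circleAverage f c r : ℝ) : EReal) := by
  have hi : CircleIntegrable f c r := hf.circleIntegrable'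
  have hi' : Integrable (fun θ => f (circleMap c r θ))
      (volume.restrict (Set.Ioc 0 (2 * Real.pi))) :=
    (intervalIntegrable_iff_integrableOn_Ioc_of_le Real.two_pi_pos.le).1 hi
  have h1 := hi'.lintegral_lt_top
  have h2 := hi'.neg.lintegral_lt_top
  simp only [Pi.neg_apply] at h2
  unfold circleMean Real.circleAverage
  rw [intervalIntegral.integral_of_le Real.two_pi_pos.le,
    integral_eq_lintegral_pos_part_sub_lintegral_neg_part hi', smul_eq_mul, EReal.coe_mul,
    EReal.coe_sub]
  simp only [← EReal.coe_neg, EReal.real_coe_toENNReal]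
  rw [EReal.coe_ennreal_toReal h1.ne, EReal.coe_ennreal_toReal h2.ne]

theorem IsSubharmonicOn.mono {u : ℂ → EReal} {Ω U : Set ℂ} (h : IsSubharmonicOn u Ω)
    (hU : IsOpen U) (hUΩ : U ⊆ Ω) : IsSubharmonicOn u U := by
  refine ⟨h.usc.mono hUΩ, fun z hz => h.lt_top z (hUΩ hz), fun z hz => ?_⟩
  obtain ⟨ρ, hρ, -, H⟩ := h.submean z (hUΩ hz)
  obtain ⟨σ, hσ, hσU⟩ := Metric.isOpen_iff.1 hU z hz
  exact ⟨min ρ σ, lt_min hρ hσ, (Metric.ball_subset_ball (min_le_right _ _)).trans hσU,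
    fun r hr hr' => H r hr (hr'.trans_le (min_le_left _ _))⟩

theorem EReal.add_coe_le_coe_iff {x : EReal} {a b : ℝ} :
    x + (a : EReal) ≤ (b : EReal) ↔ x ≤ ((b - a : ℝ) : EReal) := by
  rw [EReal.coe_sub, EReal.le_sub_iff_add_le (by simp) (by simp)]

/-- A subharmonic function that is dominated by a harmonic function at the boundary of a bounded
open set is dominated by it inside. -/
theorem IsSubharmonicOn.le_of_frontier {φ : ℂ → EReal} {h : ℂ → ℝ} {U : Set ℂ}
    (hφ : IsSubharmonicOn φ U) (hU : IsOpen U) (hb : Bornology.IsBounded U)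
    (hh : InnerProductSpace.HarmonicOnNhd h U)
    (hbd : ∀ ζ ∈ frontier U, ∀ ε : ℝ, 0 < ε → ∀ᶠ z in 𝓝[U] ζ, φ z ≤ ((h z + ε : ℝ) : EReal)) :
    ∀ z ∈ U, φ z ≤ (h z : EReal) := by
  intro z₁ hz₁
  by_contra! hlt
  obtain ⟨B, hB⟩ := hb.exists_norm_le
  obtain ⟨p, hp⟩ : ∃ p : ℝ, φ z₁ = p :=
    ⟨(φ z₁).toReal, (EReal.coe_toReal (hφ.lt_top z₁ hz₁).ne (ne_bot_of_gt hlt)).symm⟩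
  rw [hp, EReal.coe_lt_coe_iff] at hlt
  set η := (p - h z₁) / 2 with hη
  have hη0 : 0 < η := by rw [hη]; linarith
  have hB0 : 0 ≤ B := (norm_nonneg _).trans (hB z₁ hz₁)
  -- The perturbation `ε |z|^2` costs at most `η`, half the excess of `φ` over `h` at `z₁`. So the
  -- maximum of `ψ` stays away from the frontier, where `ψ` is at most about `η`, and is attained.
  set ε := η / (B ^ 2 + 1) with hε
  have hε0 : 0 < ε := by positivity
  have hεB : ∀ z ∈ U, ε * ‖z‖ ^ 2 ≤ η := by
    intro z hz
    have h1 : ‖z‖ ^ 2 ≤ B ^ 2 + 1 := by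
      have := pow_le_pow_left₀ (norm_nonneg z) (hB z hz) 2
      linarith
    calc ε * ‖z‖ ^ 2 ≤ ε * (B ^ 2 + 1) := by gcongr
      _ = η := by rw [hε]; field_simp
  have hhc : ContinuousOn h U := hh.continuousOn
  set ψ : ℂ → EReal := fun z => φ z + ((ε * ‖z‖ ^ 2 - h z : ℝ) : EReal) with hψ
  have hψusc : UpperSemicontinuousOn ψ U := by
    refine hφ.usc.add' (ContinuousOn.upperSemicontinuousOn ?_) fun z hz => ?_
    · exact continuous_coe_real_ereal.comp_continuousOn (by fun_prop)
    · exact EReal.continuousAt_add (.inr (EReal.coe_ne_bot _)) (.inr (EReal.coe_ne_top _))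
  have hψ₁ : ((2 * η : ℝ) : EReal) ≤ ψ z₁ := by
    simp only [hψ, hp]
    rw [← EReal.coe_add, EReal.coe_le_coe_iff]
    have : 0 ≤ ε * ‖z₁‖ ^ 2 := by positivity
    linarith
  set K := {z ∈ U | ψ z₁ ≤ ψ z} with hK
  have hKc : IsCompact K := by
    refine Metric.isCompact_of_isClosed_isBounded ?_ (hb.subset fun z hz => hz.1)
    refine isClosed_of_closure_subset fun z hz => ?_
    have hfr : ∃ᶠ w in 𝓝 z, w ∈ K := mem_closure_iff_frequently.1 hz
    have hfrU : ∃ᶠ w in 𝓝[U] z, w ∈ K := by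
      rw [frequently_nhdsWithin_iff]
      exact hfr.mono fun w hw => ⟨hw, hw.1⟩
    have hzU : z ∈ U := by
      by_contra hzU
      have hzf : z ∈ frontier U := by
        rw [hU.frontier_eq]
        exact ⟨closure_mono (fun w hw => hw.1) hz, hzU⟩
      obtain ⟨w, hw, hw', hwU⟩ := (hfrU.and_eventually
        ((hbd z hzf (η / 2) (by positivity)).and self_mem_nhdsWithin)).exists
      have h1 : ((2 * η : ℝ) : EReal) ≤ ψ w := hψ₁.trans hw.2
      have h2 : ψ w ≤ ((η / 2 + η : ℝ) : EReal) := by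
        simp only [hψ]
        rw [EReal.add_coe_le_coe_iff]
        refine hw'.trans ?_
        rw [EReal.coe_le_coe_iff]
        linarith [hεB w hwU]
      have h3 := EReal.coe_le_coe_iff.1 (h1.trans h2)
      linarith
    refine ⟨hzU, ?_⟩
    by_contra! hlt'
    obtain ⟨w, hw, hw'⟩ := (hfrU.and_eventually (hψusc z hzU _ hlt')).exists
    exact absurd hw.2 (not_le.2 hw')
  obtain ⟨z₀, hz₀K, hz₀⟩ := UpperSemicontinuousOn.exists_isMaxOn (s := K) ⟨z₁, hz₁, le_rfl⟩ hKc
    (hψusc.mono fun z hz => hz.1)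
  have hz₀U : z₀ ∈ U := hz₀K.1
  have hmax : ∀ z ∈ U, ψ z ≤ ψ z₀ := by
    intro z hz
    by_cases hzK : z ∈ K
    · exact hz₀ hzK
    · have : ψ z < ψ z₁ := by
        by_contra! hc
        exact hzK ⟨hz, hc⟩
      exact this.le.trans hz₀K.2
  have hφbot : φ z₀ ≠ ⊥ := by
    intro hbot
    have := hψ₁.trans hz₀K.2
    simp only [hψ, hbot, EReal.bot_add] at this
    exact EReal.coe_ne_bot _ (le_bot_iff.1 this)
  obtain ⟨q, hq⟩ : ∃ q : ℝ, φ z₀ = q :=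
    ⟨(φ z₀).toReal, (EReal.coe_toReal (hφ.lt_top z₀ hz₀U).ne hφbot).symm⟩
  set s := q + (ε * ‖z₀‖ ^ 2 - h z₀) with hs
  obtain ⟨ρ, hρ, hρU, H⟩ := hφ.submean z₀ hz₀U
  have hr : 0 < ρ / 2 := by positivity
  have hrU : Metric.closedBall z₀ |ρ / 2| ⊆ U := by
    rw [abs_of_pos hr]
    exact (Metric.closedBall_subset_ball (by linarith)).trans hρU
  -- On the circle about `z₀` of radius `ρ / 2`, `ε |z|^2` is `l` plus a constant. Hence the bound
  -- on `φ` given by maximality is harmonic there, and its value at the centre falls short of `φ z₀`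
  -- by `ε (ρ / 2)^2`.
  set l : ℂ → ℝ := fun z => ((2 * ε : ℝ) * (starRingEnd ℂ z₀) * z).re with hl
  have hlh : InnerProductSpace.HarmonicOnNhd l U := fun z _ =>
    AnalyticAt.harmonicAt_re (by fun_prop)
  set g : ℂ → ℝ := (h - l) + fun _ => s - ε * ((ρ / 2) ^ 2 - ‖z₀‖ ^ 2) with hg
  have hgh : InnerProductSpace.HarmonicOnNhd g U :=
    (hh.sub hlh).add (InnerProductSpace.harmonicOnNhd_const _)
  have hmean := H (ρ / 2) hr (by linarith)
  have hle : ∀ z ∈ Metric.sphere z₀ |ρ / 2|, φ z ≤ (g z : EReal) := by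
    intro z hz
    have h1 := hmax z (hrU (Metric.sphere_subset_closedBall hz))
    simp only [hψ, hq] at h1
    rw [← EReal.coe_add, EReal.add_coe_le_coe_iff] at h1
    refine h1.trans (EReal.coe_le_coe_iff.2 ?_)
    rw [mem_sphere_iff_norm, abs_of_pos hr] at hz
    have h2 : ‖z - z₀‖ ^ 2 = (ρ / 2) ^ 2 := by rw [hz]
    simp only [hg, hl, Pi.add_apply, Pi.sub_apply, hs]
    simp only [Complex.sq_norm, Complex.normSq_apply, Complex.sub_re, Complex.sub_im,
      Complex.mul_re, Complex.mul_im, Complex.conj_re, Complex.conj_im, Complex.ofReal_re,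
      Complex.ofReal_im] at h2 ⊢
    rw [← h2]
    apply le_of_eq
    ring
  have h3 := hmean.trans (circleMean_mono hle)
  rw [circleMean_coe (hgh.continuousOn.mono (Metric.sphere_subset_closedBall.trans hrU)),
    InnerProductSpace.HarmonicOnNhd.circleAverage_eq (hgh.mono hrU), hq, EReal.coe_le_coe_iff] at h3
  have h4 : g z₀ = q - ε * (ρ / 2) ^ 2 := by
    simp only [hg, hl, Pi.add_apply, Pi.sub_apply, hs]
    simp only [Complex.sq_norm, Complex.normSq_apply,
      Complex.mul_re, Complex.mul_im, Complex.conj_re, Complex.conj_im, Complex.ofReal_re,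
      Complex.ofReal_im]
    ring
  have h5 : 0 < ε * (ρ / 2) ^ 2 := by positivity
  linarith

/-! ### Trigonometric inequalities for the edge of the cusp -/

theorem Real.cos_rpow_mul_abs_sin_le {b θ : ℝ} (hb : 0 ≤ b) (hθ : |θ| < Real.pi / 2) :
    Real.cos θ ^ (b + 1) * |Real.sin (b * θ)| ≤ b * |Real.sin θ| := by
  have hcos : 0 < Real.cos |θ| :=
    Real.cos_pos_of_mem_Ioo ⟨by linarith [abs_nonneg θ, Real.pi_pos], hθ⟩
  rw [Real.abs_sin_eq_sin_abs_of_abs_le_pi (x := θ) (by linarith [Real.pi_pos]), ← Real.cos_abs θ]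
  have h1 : |θ| * Real.cos |θ| ≤ Real.sin |θ| := by
    have := Real.le_tan (abs_nonneg θ) hθ
    rwa [Real.tan_eq_sin_div_cos, le_div_iff₀ hcos] at this
  have h2 : Real.cos |θ| ^ (b + 1) ≤ Real.cos |θ| := by
    simpa using Real.rpow_le_rpow_of_exponent_ge hcos (Real.cos_le_one _)
      (by linarith : (1 : ℝ) ≤ b + 1)
  calc Real.cos |θ| ^ (b + 1) * |Real.sin (b * θ)|
      ≤ Real.cos |θ| * |b * θ| :=
        mul_le_mul h2 Real.abs_sin_le_abs (abs_nonneg _) hcos.le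
    _ = b * (|θ| * Real.cos |θ|) := by rw [abs_mul, abs_of_nonneg hb]; ring
    _ ≤ b * Real.sin |θ| := by gcongr

/-- A converse to `Real.cos_rpow_mul_abs_sin_le` up to a relative error of order `θ^2`: `b^2 / 6`
comes from the cubic bound for the sine, `(b + 1) / 2` from Bernoulli's inequality applied to the
power of the cosine. -/
theorem Real.le_cos_rpow_mul_abs_sin {b θ : ℝ} (hb : 0 ≤ b) (hθ : |θ| ≤ 1) (hbθ : b * |θ| ≤ 1) :
    b * |Real.sin θ| * (1 - (b ^ 2 / 6 + (b + 1) / 2) * θ ^ 2) ≤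
      Real.cos θ ^ (b + 1) * |Real.sin (b * θ)| := by
  have hπ := Real.pi_gt_three
  have hcos : 0 < Real.cos |θ| :=
    Real.cos_pos_of_mem_Ioo ⟨by linarith [abs_nonneg θ], by linarith⟩
  rw [Real.abs_sin_eq_sin_abs_of_abs_le_pi (by linarith : |θ| ≤ Real.pi),
    Real.abs_sin_eq_sin_abs_of_abs_le_pi (x := b * θ) (by rw [abs_mul, abs_of_nonneg hb]; linarith),
    abs_mul, abs_of_nonneg hb, ← Real.cos_abs θ, ← sq_abs θ]
  have hnn := abs_nonneg θ
  generalize |θ| = t at *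
  by_cases ht0 : t ≤ 0 ∨ b = 0
  · by_cases hb0 : b = 0
    · simp [hb0]
    · have : t = 0 := le_antisymm (ht0.resolve_right hb0) hnn
      simp [this]
  push Not at ht0
  obtain ⟨ht, hb0⟩ := ht0
  have hb' : 0 < b := lt_of_le_of_ne hb (Ne.symm hb0)
  have hs1 : b * t * (1 - b ^ 2 / 6 * t ^ 2) ≤ Real.sin (b * t) := by
    have := Real.sin_gt_sub_cube (mul_pos hb' ht)
    nlinarith
  have hs2 : Real.sin t ≤ t := Real.sin_le ht.le
  have hs0 : 0 ≤ Real.sin t := Real.sin_nonneg_of_nonneg_of_le_pi ht.le (by linarith)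
  have hsb : 0 ≤ Real.sin (b * t) :=
    Real.sin_nonneg_of_nonneg_of_le_pi (by positivity) (by linarith)
  have hc1 : 1 - (b + 1) / 2 * t ^ 2 ≤ Real.cos t ^ (b + 1) := by
    have h1 := one_add_mul_self_le_rpow_one_add (s := Real.cos t - 1) (by linarith)
      (by linarith : 1 ≤ b + 1)
    have h2 := Real.one_sub_sq_div_two_le_cos (x := t)
    rw [add_sub_cancel] at h1
    nlinarith
  have hF : 0 ≤ 1 - b ^ 2 / 6 * t ^ 2 := by
    have : (b * t) ^ 2 ≤ 1 := by
      have : 0 ≤ b * t := by positivity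
      nlinarith
    nlinarith
  rcases le_or_gt (1 - (b ^ 2 / 6 + (b + 1) / 2) * t ^ 2) 0 with hneg | hpos
  · exact (mul_nonpos_of_nonneg_of_nonpos (by positivity) hneg).trans (by positivity)
  calc b * Real.sin t * (1 - (b ^ 2 / 6 + (b + 1) / 2) * t ^ 2)
      ≤ b * t * (1 - (b ^ 2 / 6 + (b + 1) / 2) * t ^ 2) := by gcongr
    _ ≤ b * t * ((1 - (b + 1) / 2 * t ^ 2) * (1 - b ^ 2 / 6 * t ^ 2)) := by
        gcongr
        have : 0 ≤ (b + 1) / 2 * t ^ 2 * (b ^ 2 / 6 * t ^ 2) := by positivity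
        linarith
    _ = (1 - (b + 1) / 2 * t ^ 2) * (b * t * (1 - b ^ 2 / 6 * t ^ 2)) := by ring
    _ ≤ Real.cos t ^ (b + 1) * (b * t * (1 - b ^ 2 / 6 * t ^ 2)) := by gcongr
    _ ≤ Real.cos t ^ (b + 1) * Real.sin (b * t) := by gcongr

/-! ### The cusp and its straightening map -/

theorem mem_planarCusp_iff {C α : ℝ} (hC : 0 < C) (hα : 0 < α) {z : ℂ} :
    z ∈ planarCusp C α ↔ 0 < z.re ∧ |z.im| < (z.re / C) ^ (1 / α) := by
  have key : 0 < z.re → (C * |z.im| ^ α < z.re ↔ |z.im| < (z.re / C) ^ (1 / α)) := by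
    intro hz
    rw [one_div, Real.lt_rpow_inv_iff_of_pos (abs_nonneg _) (by positivity) hα, lt_div_iff₀ hC,
      mul_comm]
  constructor
  · intro h
    have h' : C * |z.im| ^ α < z.re := h
    have hz : 0 < z.re := lt_of_le_of_lt (by positivity) h'
    exact ⟨hz, (key hz).1 h'⟩
  · rintro ⟨hz, h⟩
    exact (key hz).2 h

theorem isOpen_planarCusp {C α : ℝ} (hα : 0 < α) : IsOpen (planarCusp C α) := by
  refine isOpen_lt ?_ Complex.continuous_re
  exact continuous_const.mul ((continuous_abs.comp Complex.continuous_im).rpow_const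
    fun _ => Or.inr hα.le)

theorem ofReal_mem_planarCusp {C α x : ℝ} (hα : 0 < α) (hx : 0 < x) :
    (x : ℂ) ∈ planarCusp C α := by
  simp [planarCusp, Real.zero_rpow hα.ne', hx]

noncomputable section

/-- The map `z ↦ z ^ (-b) - c z ^ b` on the right half-plane. For `b = 1 / α - 1` it straightens
the cusp `planarCusp C α` near its vertex to a half-strip, up to a small error. -/
def cuspMap (b c : ℝ) (z : ℂ) : ℂ :=
  Complex.exp (-(b * Complex.log z)) - c * Complex.exp (b * Complex.log z)

/-- The harmonic function `Re exp (-A w)` in the coordinate `w = cuspMap b c z`. -/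
def cuspBarrier (A b c : ℝ) (z : ℂ) : ℝ :=
  (Complex.exp (-(A * cuspMap b c z))).re

end

theorem analyticAt_cuspMap (b c : ℝ) {z : ℂ} (hz : z ∈ Complex.slitPlane) :
    AnalyticAt ℂ (cuspMap b c) z := by
  have := analyticAt_clog hz
  unfold cuspMap
  fun_prop

theorem harmonicAt_cuspBarrier (A b c : ℝ) {z : ℂ} (hz : z ∈ Complex.slitPlane) :
    InnerProductSpace.HarmonicAt (cuspBarrier A b c) z := by
  have := analyticAt_cuspMap b c hz
  exact AnalyticAt.harmonicAt_re (f := fun z => Complex.exp (-(A * cuspMap b c z))) (by fun_prop)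

theorem cuspMap_re (b c : ℝ) {z : ℂ} (hz : z ≠ 0) :
    (cuspMap b c z).re = (‖z‖ ^ (-b) - c * ‖z‖ ^ b) * Real.cos (b * z.arg) := by
  have hn : 0 < ‖z‖ := norm_pos_iff.2 hz
  simp only [cuspMap, Complex.sub_re, Complex.exp_re, Complex.neg_re, Complex.neg_im,
    Complex.re_ofReal_mul, Complex.im_ofReal_mul, Complex.log_re, Complex.log_im, Real.cos_neg,
    Real.rpow_def_of_pos hn]
  rw [mul_neg, mul_comm b (Real.log _)]
  ring

theorem cuspMap_im (b c : ℝ) {z : ℂ} (hz : z ≠ 0) :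
    (cuspMap b c z).im = -((‖z‖ ^ (-b) + c * ‖z‖ ^ b) * Real.sin (b * z.arg)) := by
  have hn : 0 < ‖z‖ := norm_pos_iff.2 hz
  simp only [cuspMap, Complex.sub_im, Complex.exp_im, Complex.neg_re, Complex.neg_im,
    Complex.re_ofReal_mul, Complex.im_ofReal_mul, Complex.log_re, Complex.log_im, Real.sin_neg,
    Real.rpow_def_of_pos hn]
  rw [mul_neg (Real.log _), mul_comm b (Real.log _)]
  ring

theorem cuspBarrier_eq (A b c : ℝ) (z : ℂ) :
    cuspBarrier A b c z =
      Real.exp (-(A * (cuspMap b c z).re)) * Real.cos (A * (cuspMap b c z).im) := by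
  simp [cuspBarrier, Complex.exp_re]

theorem cuspBarrier_ofReal (A b c : ℝ) {t : ℝ} (ht : 0 < t) :
    cuspBarrier A b c t = Real.exp (-(A * (t ^ (-b) - c * t ^ b))) := by
  have h0 : (t : ℂ) ≠ 0 := by exact_mod_cast ht.ne'
  rw [cuspBarrier_eq, cuspMap_re b c h0, cuspMap_im b c h0, Complex.arg_ofReal_of_nonneg ht.le]
  simp [abs_of_pos ht]

/-- All powers of `‖z‖` but one cancel, so comparing the image of the edge with the strip reduces to
comparing `cos θ ^ (b + 1) * |sin (b θ)|` with `b * |sin θ|`. -/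
theorem strip_scaling {C b : ℝ} (hC : 0 < C) (hb : 0 < b) {z : ℂ} (hz : 0 < z.re) (S : ℝ) :
    Real.pi * C ^ (b + 1) / (2 * b) * (‖z‖ ^ (-b) * S) * (z.re / C) ^ (b + 1) =
      Real.pi / (2 * b) * ‖z‖ * (Real.cos z.arg ^ (b + 1) * S) := by
  have hn : 0 < ‖z‖ := norm_pos_iff.2 (by rintro rfl; simp at hz)
  have hcos : 0 ≤ Real.cos z.arg := by
    rw [← Complex.norm_mul_cos_arg] at hz
    exact (pos_of_mul_pos_right hz hn.le).le
  rw [Real.div_rpow hz.le hC.le, ← Complex.norm_mul_cos_arg, Real.mul_rpow hn.le hcos,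
    Real.rpow_neg hn.le, Real.rpow_add hn, Real.rpow_one]
  have h1 : ‖z‖ ^ b ≠ 0 := (Real.rpow_pos_of_pos hn _).ne'
  have h2 : C ^ (b + 1) ≠ 0 := (Real.rpow_pos_of_pos hC _).ne'
  field_simp

/-- The map `z ↦ z ^ (-b)` sends the cusp into a strip. -/
theorem abs_im_cuspMap_zero_mul_le {C b : ℝ} (hC : 0 < C) (hb : 0 < b) {z : ℂ} (hz : 0 < z.re) :
    Real.pi * C ^ (b + 1) / (2 * b) * |(cuspMap b 0 z).im| * (z.re / C) ^ (b + 1) ≤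
      Real.pi / 2 * |z.im| := by
  have h0 : z ≠ 0 := by rintro rfl; simp at hz
  have hn : 0 < ‖z‖ := norm_pos_iff.2 h0
  have h1 := Real.cos_rpow_mul_abs_sin_le hb.le (Complex.abs_arg_lt_pi_div_two_iff.2 (.inl hz))
  rw [cuspMap_im b 0 h0, abs_neg, abs_mul, zero_mul, add_zero,
    abs_of_pos (Real.rpow_pos_of_pos hn _), strip_scaling hC hb hz]
  calc _ ≤ Real.pi / (2 * b) * ‖z‖ * (b * |Real.sin z.arg|) := by gcongr
    _ = Real.pi / 2 * |z.im| := by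
      rw [← Complex.norm_mul_sin_arg z, abs_mul, abs_of_pos hn]
      field_simp

theorem cuspBarrier_zero_pos {C b : ℝ} (hC : 0 < C) (hb : 0 < b) {z : ℂ} (hz : 0 < z.re)
    (hz' : |z.im| < (z.re / C) ^ (b + 1)) :
    0 < cuspBarrier (Real.pi * C ^ (b + 1) / (2 * b)) b 0 z := by
  have hA : 0 < Real.pi * C ^ (b + 1) / (2 * b) := by positivity
  rw [cuspBarrier_eq]
  refine mul_pos (Real.exp_pos _) (Real.cos_pos_of_mem_Ioo (abs_lt.1 ?_))
  rw [abs_mul, abs_of_pos hA]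
  have h1 := abs_im_cuspMap_zero_mul_le hC hb hz
  have h2 : 0 < (z.re / C) ^ (b + 1) := by positivity
  refine lt_of_mul_lt_mul_right (h1.trans_lt ?_) h2.le
  gcongr

/-- Follows from `|θ| ≤ tan |θ| = |y| / x ≤ x^b / C^(b+1)`. -/
theorem abs_arg_le_of_cusp {C b : ℝ} (hC : 0 < C) (hb : 0 < b) {z : ℂ} (hz : 0 < z.re)
    (hz' : |z.im| ≤ (z.re / C) ^ (b + 1)) : |z.arg| ≤ (C ^ (b + 1))⁻¹ * ‖z‖ ^ b := by
  have hlt := Complex.abs_arg_lt_pi_div_two_iff.2 (Or.inl hz)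
  have hcos : 0 < Real.cos |z.arg| :=
    Real.cos_pos_of_mem_Ioo ⟨by linarith [abs_nonneg z.arg, Real.pi_pos], hlt⟩
  have hn : 0 < ‖z‖ := norm_pos_iff.2 (by rintro rfl; simp at hz)
  have h1 := Real.le_tan (abs_nonneg _) hlt
  rw [Real.tan_eq_sin_div_cos, ← Real.abs_sin_eq_sin_abs_of_abs_le_pi (Complex.abs_arg_le_pi z),
    Real.cos_abs, ← mul_div_mul_left _ _ hn.ne', Complex.norm_mul_cos_arg, ← abs_of_pos hn,
    ← abs_mul, Complex.norm_mul_sin_arg] at h1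
  refine h1.trans ?_
  rw [div_le_iff₀ hz]
  refine hz'.trans ?_
  rw [Real.div_rpow hz.le hC.le, Real.rpow_add hz, Real.rpow_one, div_eq_inv_mul, mul_assoc]
  gcongr
  exact Complex.re_le_norm z

/-- For a suitable `c > 0`, near the vertex, `cuspMap b c` sends the boundary of the cusp
outside of the strip of half-width `π / 2A`. -/
theorem exists_cuspMap_boundary {C b : ℝ} (hC : 0 < C) (hb : 0 < b) {R : ℝ} (hR : 0 < R) :
    ∃ c δ : ℝ, 0 < c ∧ 0 < δ ∧ δ < R ∧
      ∀ z : ℂ, 0 < z.re → ‖z‖ ≤ δ → |z.im| ≤ (z.re / C) ^ (b + 1) →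
        b * |z.arg| ≤ 1 ∧ c * ‖z‖ ^ b ≤ ‖z‖ ^ (-b) ∧
        (|z.im| = (z.re / C) ^ (b + 1) →
          Real.pi / 2 < Real.pi * C ^ (b + 1) / (2 * b) * |(cuspMap b c z).im|) := by
  set κ := (C ^ (b + 1))⁻¹ with hκ
  have hκ0 : 0 < κ := by positivity
  set D := b ^ 2 / 6 + (b + 1) / 2 with hD
  have hD0 : 0 < D := by positivity
  have hlim : Tendsto (fun r : ℝ => r ^ b) (𝓝 0) (𝓝 0) := by
    simpa [Real.zero_rpow hb.ne'] using
      (Real.continuous_rpow_const hb.le).tendsto 0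
  have hev : ∀ᶠ r : ℝ in 𝓝 0, κ * r ^ b < 1 ∧ b * (κ * r ^ b) < 1 ∧
      (2 * D * κ ^ 2) * (r ^ b * r ^ b) < 1 := by
    have h1 : Tendsto (fun r : ℝ => κ * r ^ b) (𝓝 0) (𝓝 0) := by
      simpa using hlim.const_mul κ
    have h2 : Tendsto (fun r : ℝ => b * (κ * r ^ b)) (𝓝 0) (𝓝 0) := by
      simpa using h1.const_mul b
    have h3 : Tendsto (fun r : ℝ => (2 * D * κ ^ 2) * (r ^ b * r ^ b)) (𝓝 0) (𝓝 0) := by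
      simpa using (hlim.mul hlim).const_mul (2 * D * κ ^ 2)
    exact (h1.eventually_lt_const one_pos).and
      ((h2.eventually_lt_const one_pos).and (h3.eventually_lt_const one_pos))
  obtain ⟨δ₁, hδ₁, H⟩ := Metric.eventually_nhds_iff.1 hev
  -- The edge misses the side of the strip by a relative error at most `D θ^2 ≤ s = D κ^2 ‖z‖^(2b)`,
  -- while `-c z^b` enlarges the imaginary part by the factor `1 + c ‖z‖^(2b)`. Taking `c = 2 D κ^2`
  -- makes this `1 + 2s`, and `(1 - s) (1 + 2s) > 1` once `2s < 1`.
  refine ⟨2 * D * κ ^ 2, min (δ₁ / 2) (R / 2), by positivity, by positivity,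
    (min_le_right _ _).trans_lt (by linarith), ?_⟩
  intro z hz hzδ hzc
  have h0 : z ≠ 0 := by rintro rfl; simp at hz
  have hn : 0 < ‖z‖ := norm_pos_iff.2 h0
  obtain ⟨h1, h2, h3⟩ := H (y := ‖z‖) (by
    rw [dist_zero_right, norm_norm]
    exact (hzδ.trans (min_le_left _ _)).trans_lt (by linarith))
  have harg : |z.arg| ≤ κ * ‖z‖ ^ b := abs_arg_le_of_cusp hC hb hz hzc
  have hbarg : b * |z.arg| ≤ 1 := (mul_le_mul_of_nonneg_left harg hb.le).trans h2.le
  have hs : 0 < ‖z‖ ^ b := Real.rpow_pos_of_pos hn _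
  refine ⟨hbarg, ?_, fun heq => ?_⟩
  · rw [Real.rpow_neg hn.le, ← one_div, le_div_iff₀ hs, mul_assoc]
    exact h3.le
  have hP : 0 < (z.re / C) ^ (b + 1) := by positivity
  have hlow := Real.le_cos_rpow_mul_abs_sin hb.le (harg.trans h1.le) hbarg
  have hθ : D * z.arg ^ 2 ≤ D * κ ^ 2 * (‖z‖ ^ b * ‖z‖ ^ b) := by
    rw [← sq_abs]
    calc D * |z.arg| ^ 2 ≤ D * (κ * ‖z‖ ^ b) ^ 2 := by gcongr
      _ = _ := by ring
  set s := D * κ ^ 2 * (‖z‖ ^ b * ‖z‖ ^ b) with hsdef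
  have hs0 : 0 < s := by positivity
  have hs1 : 2 * s < 1 := by rw [hsdef]; linarith
  have hsin : 0 < |Real.sin z.arg| := by
    have : 0 < |z.im| := heq ▸ hP
    rw [← Complex.norm_mul_sin_arg z, abs_mul, abs_of_pos hn] at this
    exact pos_of_mul_pos_right this hn.le
  have hfac : (‖z‖ ^ (-b) + 2 * D * κ ^ 2 * ‖z‖ ^ b) = ‖z‖ ^ (-b) * (1 + 2 * s) := by
    rw [Real.rpow_neg hn.le, hsdef]
    field_simp
  rw [cuspMap_im b _ h0, abs_neg, abs_mul, hfac, abs_of_pos (by positivity)]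
  refine lt_of_mul_lt_mul_right ?_ hP.le
  rw [mul_assoc (‖z‖ ^ (-b)), strip_scaling hC hb hz]
  have h5 : b * |Real.sin z.arg| <
      Real.cos z.arg ^ (b + 1) * ((1 + 2 * s) * |Real.sin (b * z.arg)|) := by
    calc b * |Real.sin z.arg| < b * |Real.sin z.arg| * (1 - s) * (1 + 2 * s) := by
          have h6 : 0 < b * |Real.sin z.arg| := by positivity
          have h7 : 1 < (1 - s) * (1 + 2 * s) := by nlinarith
          rw [mul_assoc]
          exact lt_mul_of_one_lt_right h6 h7
      _ ≤ (b * |Real.sin z.arg| * (1 - D * z.arg ^ 2)) * (1 + 2 * s) := by gcongr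
      _ ≤ (Real.cos z.arg ^ (b + 1) * |Real.sin (b * z.arg)|) * (1 + 2 * s) := by gcongr
      _ = _ := by ring
  calc Real.pi / 2 * (z.re / C) ^ (b + 1)
      = Real.pi / (2 * b) * ‖z‖ * (b * |Real.sin z.arg|) := by
        rw [← heq, ← Complex.norm_mul_sin_arg z, abs_mul, abs_of_pos hn]
        field_simp
    _ < _ := by gcongr

/-! ### Gluing a competitor from harmonic pieces -/

theorem circleAverage_max_ge {f g : ℂ → ℝ} {z : ℂ} {r : ℝ} (hr : 0 < r)
    (hf : InnerProductSpace.HarmonicOnNhd f (Metric.closedBall z r))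
    (hg : InnerProductSpace.HarmonicOnNhd g (Metric.closedBall z r)) :
    max (f z) (g z) ≤ Real.circleAverage (fun w => max (f w) (g w)) z r := by
  rw [← abs_of_pos hr] at hf hg
  have hfc := hf.continuousOn.mono Metric.sphere_subset_closedBall
  have hgc := hg.continuousOn.mono Metric.sphere_subset_closedBall
  have hm : CircleIntegrable (fun w => max (f w) (g w)) z r := (hfc.sup hgc).circleIntegrable'
  refine max_le ?_ ?_
  · rw [← InnerProductSpace.HarmonicOnNhd.circleAverage_eq hf]
    exact Real.circleAverage_mono hfc.circleIntegrable' hm fun _ _ => le_max_left _ _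
  · rw [← InnerProductSpace.HarmonicOnNhd.circleAverage_eq hg]
    exact Real.circleAverage_mono hgc.circleIntegrable' hm fun _ _ => le_max_right _ _

theorem continuousAt_and_submean_of_eq_max {φ : ℂ → EReal} {V : Set ℂ} {f g : ℂ → ℝ}
    (hV : IsOpen V) (hf : InnerProductSpace.HarmonicOnNhd f V)
    (hg : InnerProductSpace.HarmonicOnNhd g V)
    (hφ : ∀ z ∈ V, φ z = ((max (f z) (g z) : ℝ) : EReal)) {z : ℂ} (hz : z ∈ V) :
    ContinuousAt φ z ∧ ∃ ρ : ℝ, 0 < ρ ∧ Metric.ball z ρ ⊆ V ∧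
      ∀ r : ℝ, 0 < r → r < ρ → φ z ≤ circleMean φ z r := by
  have hc : ContinuousOn (fun w => max (f w) (g w)) V := hf.continuousOn.sup hg.continuousOn
  refine ⟨?_, ?_⟩
  · have h1 : ContinuousAt (fun w => ((max (f w) (g w) : ℝ) : EReal)) z :=
      continuous_coe_real_ereal.continuousAt.comp (hc.continuousAt (hV.mem_nhds hz))
    exact h1.congr (by filter_upwards [hV.mem_nhds hz] with w hw using (hφ w hw).symm)
  · obtain ⟨ρ, hρ, hρV⟩ := Metric.isOpen_iff.1 hV z hz
    refine ⟨ρ, hρ, hρV, fun r hr hrρ => ?_⟩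
    have hcb : Metric.closedBall z r ⊆ V := (Metric.closedBall_subset_ball hrρ).trans hρV
    have hsb : Metric.sphere z |r| ⊆ V := by
      rw [abs_of_pos hr]
      exact Metric.sphere_subset_closedBall.trans hcb
    calc φ z = ((max (f z) (g z) : ℝ) : EReal) := hφ z hz
      _ ≤ ((Real.circleAverage (fun w => max (f w) (g w)) z r : ℝ) : EReal) :=
          EReal.coe_le_coe_iff.2 (circleAverage_max_ge hr (hf.mono hcb) (hg.mono hcb))
      _ = circleMean (fun w => ((max (f w) (g w) : ℝ) : EReal)) z r :=
          (circleMean_coe (hc.mono hsb)).symm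
      _ ≤ circleMean φ z r := circleMean_mono fun w hw => (hφ w (hsb hw)).ge

/-- Away from the pole, the Green function is bounded below by a multiple of any negative
harmonic function. -/
theorem exists_neg_mul_le_greenFunction {Ω : Set ℂ} {a : ℂ} {h : ℂ → ℝ} {T ε : ℝ}
    (hΩ : IsOpen Ω) (ha : a ∈ Ω) (hT : ∀ z ∈ Ω, ‖z - a‖ < T)
    (hh : InnerProductSpace.HarmonicOnNhd h Ω) (hpos : ∀ z ∈ Ω, 0 < h z) (hε : 0 < ε) :
    ∃ c : ℝ, 0 < c ∧ ∀ z ∈ Ω, ε ≤ ‖z - a‖ →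
      ((-(c * h z) : ℝ) : EReal) ≤ greenFunction Ω z a := by
  have hT0 : 0 < T := by simpa using hT a ha
  obtain ⟨σ, hσ, hσΩ⟩ := Metric.isOpen_iff.1 hΩ a ha
  obtain ⟨r, hr, hrε, hrσ⟩ : ∃ r : ℝ, 0 < r ∧ r ≤ ε ∧ 2 * r < σ :=
    ⟨min ε (σ / 3), by positivity, min_le_left _ _, by
      have := min_le_right ε (σ / 3)
      linarith⟩
  have hball : Metric.closedBall a (2 * r) ⊆ Ω :=
    (Metric.closedBall_subset_ball hrσ).trans hσΩ
  obtain ⟨z₀, hz₀, hmin⟩ := (isCompact_closedBall a (2 * r)).exists_isMinOn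
    ⟨a, Metric.mem_closedBall_self (by positivity)⟩ (hh.continuousOn.mono hball)
  have hm : 0 < h z₀ := hpos z₀ (hball hz₀)
  set L : ℂ → ℝ := fun z => Real.log ‖(z - a) / (T : ℂ)‖ with hL
  have hLeq : ∀ z, z ≠ a → L z = Real.log ‖z - a‖ - Real.log T := by
    intro z hz
    have : ‖z - a‖ ≠ 0 := norm_ne_zero_iff.2 (sub_ne_zero.2 hz)
    simp only [hL, norm_div, Complex.norm_real, Real.norm_eq_abs, abs_of_pos hT0]
    rw [Real.log_div this hT0.ne']
  have hLh : InnerProductSpace.HarmonicOnNhd L {z | z ≠ a} := fun z hz =>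
    AnalyticAt.harmonicAt_log_norm (by fun_prop (disch := exact_mod_cast hT0.ne'))
      (div_ne_zero (sub_ne_zero.2 hz) (by exact_mod_cast hT0.ne'))
  have hLneg : ∀ z ∈ Ω, z ≠ a → L z < 0 := by
    intro z hz hza
    rw [hLeq z hza, sub_neg]
    exact Real.log_lt_log (norm_pos_iff.2 (sub_ne_zero.2 hza)) (hT z hz)
  -- Large enough that `-c h < L` on the annulus `r / 2 < |z - a| < 2r`; there the maximum is `L`,
  -- so the two formulas for `φ` agree on an overlap.
  set c := (|Real.log (r / 2) - Real.log T| + 1) / h z₀ with hc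
  have hc0 : 0 < c := by positivity
  have hmid : ∀ z, r / 2 < ‖z - a‖ → ‖z - a‖ < 2 * r → max (L z) (-(c * h z)) = L z := by
    intro z hz1 hz2
    refine max_eq_left ?_
    have hza : z ≠ a := by
      rintro rfl
      simp at hz1
      linarith
    have h1 : h z₀ ≤ h z := hmin (by rw [Metric.mem_closedBall, dist_eq_norm]; exact hz2.le)
    have h2 : |Real.log (r / 2) - Real.log T| + 1 ≤ c * h z := by
      calc _ = c * h z₀ := by rw [hc]; field_simp
        _ ≤ c * h z := by gcongr
    have h3 := Real.log_lt_log (by positivity) hz1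
    rw [hLeq z hza]
    linarith [neg_abs_le (Real.log (r / 2) - Real.log T)]
  classical
  -- The value at `a` is set by hand, because `Real.log 0 = 0`.
  set φ : ℂ → EReal := fun z => if z = a then ⊥ else
    if ‖z - a‖ < r then (L z : EReal) else ((max (L z) (-(c * h z)) : ℝ) : EReal) with hφ
  set V₁ : Set ℂ := Metric.ball a (2 * r) ∩ {z | z ≠ a} with hV₁
  set V₂ : Set ℂ := Ω ∩ {z | r / 2 < ‖z - a‖} with hV₂
  have hV₁o : IsOpen V₁ := Metric.isOpen_ball.inter isOpen_ne
  have hV₂o : IsOpen V₂ := hΩ.inter (isOpen_lt continuous_const (by fun_prop))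
  have hV₁Ω : V₁ ⊆ Ω := fun z hz => hball (Metric.ball_subset_closedBall hz.1)
  have hV₂a : V₂ ⊆ {z | z ≠ a} := by
    rintro z ⟨-, hz⟩ rfl
    simp at hz
    linarith
  have hφ₁ : ∀ z ∈ V₁, φ z = ((max (L z) (L z) : ℝ) : EReal) := by
    intro z hz
    have h1 : z ≠ a := hz.2
    have h2 : ‖z - a‖ < 2 * r := by simpa [dist_eq_norm] using hz.1
    simp only [hφ, if_neg h1, max_self]
    split_ifs with h3
    · rfl
    · rw [hmid z (by linarith) h2]
  have hφ₂ : ∀ z ∈ V₂, φ z = ((max (L z) (-(c * h z)) : ℝ) : EReal) := by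
    intro z hz
    have h1 : z ≠ a := hV₂a hz
    simp only [hφ, if_neg h1]
    split_ifs with h3
    · rw [hmid z hz.2 (by linarith)]
    · rfl
  have hchh : InnerProductSpace.HarmonicOnNhd (fun z => -(c * h z)) Ω :=
    (hh.const_smul (c := c)).neg
  have hloc : ∀ z ∈ Ω, z ≠ a → ContinuousAt φ z ∧ ∃ ρ : ℝ, 0 < ρ ∧ Metric.ball z ρ ⊆ Ω ∧
      ∀ r : ℝ, 0 < r → r < ρ → φ z ≤ circleMean φ z r := by
    intro z hz hza
    by_cases h1 : ‖z - a‖ < 2 * r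
    · obtain ⟨hcont, ρ, hρ, hρV, H⟩ := continuousAt_and_submean_of_eq_max hV₁o
        (hLh.mono fun w hw => hw.2) (hLh.mono fun w hw => hw.2) hφ₁ (z := z)
        ⟨by simpa [dist_eq_norm] using h1, hza⟩
      exact ⟨hcont, ρ, hρ, hρV.trans hV₁Ω, H⟩
    · obtain ⟨hcont, ρ, hρ, hρV, H⟩ := continuousAt_and_submean_of_eq_max hV₂o
        (hLh.mono hV₂a) (hchh.mono fun w hw => hw.1) hφ₂ (z := z)
        ⟨hz, by simp only [Set.mem_ofPred_eq]; linarith⟩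
      exact ⟨hcont, ρ, hρ, hρV.trans fun w hw => hw.1, H⟩
  have hφa : φ a = ⊥ := by simp [hφ]
  have hφlog : ∀ᶠ z in 𝓝[≠] a, φ z = ((Real.log ‖z - a‖ - Real.log T : ℝ) : EReal) := by
    have : ∀ᶠ z in 𝓝[≠] a, z ∈ Metric.ball a (2 * r) :=
      nhdsWithin_le_nhds (Metric.ball_mem_nhds a (by positivity))
    filter_upwards [this, self_mem_nhdsWithin] with z hz hza
    rw [hφ₁ z ⟨hz, hza⟩, max_self, hLeq z hza]
  have hmem : φ ∈ greenFamily Ω a := by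
    refine ⟨⟨fun z hz => ?_, fun z hz => ?_, fun z hz => ?_⟩, fun z hz => ?_,
      |Real.log T|, ?_⟩
    · by_cases hza : z = a
      · rw [hza]
        intro y hy
        rw [hφa] at hy
        obtain ⟨q, -, hq⟩ := EReal.lt_iff_exists_real_btwn.1 hy
        have hnorm : Tendsto (fun z : ℂ => ‖z - a‖) (𝓝[≠] a) (𝓝[>] 0) :=
          tendsto_norm_sub_self_nhdsNE a
        have hlog := (Real.tendsto_log_nhdsGT_zero.comp hnorm).eventually_lt_atBot
          (q + Real.log T)
        have hev : ∀ᶠ z in 𝓝[≠] a, φ z < y := by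
          filter_upwards [hφlog, hlog] with z hz1 hz2
          rw [hz1]
          refine lt_trans (EReal.coe_lt_coe_iff.2 ?_) hq
          simp only [Function.comp_apply] at hz2
          linarith
        refine nhdsWithin_le_nhds ?_
        rw [eventually_nhdsWithin_iff] at hev
        filter_upwards [hev] with z hz
        by_cases h : z = a
        · rwa [h, hφa]
        · exact hz h
      · exact (hloc z hz hza).1.upperSemicontinuousAt.upperSemicontinuousWithinAt _
    · simp only [hφ]
      split_ifs
      · exact bot_lt_top
      · exact EReal.coe_lt_top _
      · exact EReal.coe_lt_top _
    · by_cases hza : z = a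
      · exact ⟨σ, hσ, hza ▸ hσΩ, fun r _ _ => by rw [hza, hφa]; exact bot_le⟩
      · exact (hloc z hz hza).2
    · simp only [hφ]
      split_ifs with h1 h2
      · exact EReal.bot_lt_zero
      · exact_mod_cast hLneg z hz h1
      · have : 0 < c * h z := mul_pos hc0 (hpos z hz)
        exact_mod_cast max_lt (hLneg z hz h1) (by linarith)
    · filter_upwards [hφlog] with z hz
      rw [hz, EReal.coe_le_coe_iff, EReal.coe_le_coe_iff]
      constructor <;> linarith [le_abs_self (Real.log T), neg_abs_le (Real.log T)]
  refine ⟨c, hc0, fun z hz hzε => ?_⟩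
  calc ((-(c * h z) : ℝ) : EReal) ≤ φ z := by
        rw [hφ₂ z ⟨hz, by simp only [Set.mem_ofPred_eq]; linarith⟩, EReal.coe_le_coe_iff]
        exact le_max_right _ _
    _ ≤ greenFunction Ω z a := le_iSup₂ (f := fun φ (_ : φ ∈ greenFamily Ω a) => φ z) φ hmem

/-! ### Uniform negativity of the competitors -/

theorem harmonicAt_log_norm_sub_div (q : ℂ) {T : ℝ} (hT : 0 < T) {z : ℂ} (hz : z ≠ q) :
    InnerProductSpace.HarmonicAt (fun z => Real.log (‖z - q‖ / T)) z := by
  have hT' : (T : ℂ) ≠ 0 := by exact_mod_cast hT.ne'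
  have h : InnerProductSpace.HarmonicAt (fun z => Real.log ‖(z - q) / (T : ℂ)‖) z :=
    AnalyticAt.harmonicAt_log_norm (by fun_prop (disch := exact hT'))
      (div_ne_zero (sub_ne_zero.2 hz) hT')
  simpa only [norm_div, Complex.norm_real, Real.norm_eq_abs, abs_of_pos hT] using h

theorem InnerProductSpace.HarmonicAt.continuousAt {f : ℂ → ℝ} {z : ℂ}
    (h : InnerProductSpace.HarmonicAt f z) : ContinuousAt f z :=
  h.1.continuousAt

theorem eventually_le_add_of_continuousAt {φ : ℂ → EReal} {h : ℂ → ℝ} {U : Set ℂ} {ζ : ℂ}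
    {M : ℝ} (hc : ContinuousAt h ζ) (hM : M ≤ h ζ) (hφ : ∀ᶠ z in 𝓝[U] ζ, φ z ≤ (M : EReal))
    {ε : ℝ} (hε : 0 < ε) : ∀ᶠ z in 𝓝[U] ζ, φ z ≤ ((h z + ε : ℝ) : EReal) := by
  have h1 : ∀ᶠ z in 𝓝[U] ζ, M - ε < h z :=
    nhdsWithin_le_nhds (hc.eventually_const_lt (by linarith))
  filter_upwards [hφ, h1] with z hz1 hz2
  exact hz1.trans (EReal.coe_le_coe_iff.2 (by linarith))

/-- Halving the logarithm absorbs the `O(1)` term at the pole, whose size depends on `φ`; the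
resulting bound is the same for all competitors. -/
theorem le_log_of_mem_greenFamily {Ω : Set ℂ} {a : ℂ} {φ : ℂ → EReal} {ρ : ℝ}
    (hφ : φ ∈ greenFamily Ω a) (hρ : 0 < ρ) (hρΩ : Metric.ball a ρ ⊆ Ω) {z : ℂ}
    (hz : z ∈ Metric.ball a ρ) (hza : z ≠ a) :
    φ z ≤ ((1 / 2 * Real.log (‖z - a‖ / ρ) : ℝ) : EReal) := by
  obtain ⟨hsub, hneg, M, hM⟩ := hφ
  set U : Set ℂ := Metric.ball a ρ ∩ {z | z ≠ a} with hU
  have hUo : IsOpen U := Metric.isOpen_ball.inter isOpen_ne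
  have hUΩ : U ⊆ Ω := fun w hw => hρΩ hw.1
  have hharm : ∀ w, w ≠ a →
      InnerProductSpace.HarmonicAt (fun z => 1 / 2 * Real.log (‖z - a‖ / ρ)) w := fun w hw =>
    (harmonicAt_log_norm_sub_div a hρ hw).const_smul (c := (1 / 2 : ℝ))
  refine (hsub.mono hUo hUΩ).le_of_frontier hUo (Metric.isBounded_ball.subset Set.inter_subset_left)
    (fun w hw => hharm w hw.2) (fun ζ hζ ε hε => ?_) z ⟨hz, hza⟩
  rw [hUo.frontier_eq] at hζ
  by_cases hζa : ζ = a
  · subst hζa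
    have h1 : ∀ᶠ w in 𝓝[U] ζ, φ w ≤ ((Real.log ‖w - ζ‖ + M : ℝ) : EReal) :=
      nhdsWithin_mono ζ (fun w hw => hw.2) (hM.mono fun w hw => hw.2)
    have h2 : ∀ᶠ w in 𝓝[U] ζ, Real.log ‖w - ζ‖ < -Real.log ρ - 2 * M :=
      nhdsWithin_mono ζ (fun w hw => hw.2) ((Real.tendsto_log_nhdsGT_zero.comp
        (tendsto_norm_sub_self_nhdsNE ζ)).eventually_lt_atBot _)
    filter_upwards [h1, h2, self_mem_nhdsWithin] with w hw1 hw2 hwU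
    refine hw1.trans (EReal.coe_le_coe_iff.2 ?_)
    have : ‖w - ζ‖ ≠ 0 := norm_ne_zero_iff.2 (sub_ne_zero.2 hwU.2)
    rw [Real.log_div this hρ.ne']
    linarith
  · have hge : ρ ≤ ‖ζ - a‖ := by
      by_contra! hlt
      exact hζ.2 ⟨by simpa [dist_eq_norm] using hlt, hζa⟩
    refine eventually_le_add_of_continuousAt (M := 0) (hharm ζ hζa).continuousAt ?_ ?_ hε
    · have : 0 ≤ Real.log (‖ζ - a‖ / ρ) := Real.log_nonneg ((one_le_div hρ).2 hge)
      positivity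
    · filter_upwards [self_mem_nhdsWithin] with w hw using (hneg w (hUΩ hw)).le

/-- Quantitative propagation of negativity from a small disk to a larger concentric one. -/
theorem IsSubharmonicOn.le_of_le_on_ball {Ω : Set ℂ} {φ : ℂ → EReal} {q : ℂ} {s T m : ℝ}
    (hφ : IsSubharmonicOn φ Ω) (hneg : ∀ z ∈ Ω, φ z < 0) (hs : 0 < s) (hsT : s < T)
    (hTΩ : Metric.ball q T ⊆ Ω) (hm : 0 < m)
    (hle : ∀ z ∈ Metric.ball q s, φ z ≤ ((-m : ℝ) : EReal)) {z : ℂ}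
    (hz : z ∈ Metric.ball q (T / 2)) :
    φ z ≤ ((-(min m (m / Real.log (T / (s / 2)) * Real.log 2)) : ℝ) : EReal) := by
  have hT : 0 < T := hs.trans hsT
  rcases lt_or_ge ‖z - q‖ s with hzs | hzs
  · refine (hle z (by simpa [dist_eq_norm] using hzs)).trans (EReal.coe_le_coe_iff.2 ?_)
    linarith [min_le_left m (m / Real.log (T / (s / 2)) * Real.log 2)]
  have hlog : 0 < Real.log (T / (s / 2)) :=
    Real.log_pos ((one_lt_div (by positivity)).2 (by linarith))
  set κ := m / Real.log (T / (s / 2)) with hκ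
  have hκ0 : 0 < κ := by positivity
  -- The inner radius is `s / 2` rather than `s`, so that `φ ≤ -m` holds in a full neighbourhood of
  -- the inner circle. There `κ log (|z - q| / T)` equals `-m`.
  set U : Set ℂ := Metric.ball q T ∩ {z | s / 2 < ‖z - q‖} with hU
  have hUo : IsOpen U := Metric.isOpen_ball.inter (isOpen_lt continuous_const (by fun_prop))
  have hUΩ : U ⊆ Ω := fun w hw => hTΩ hw.1
  have hne : ∀ w, s / 2 ≤ ‖w - q‖ → w ≠ q := by
    rintro w hw rfl
    simp at hw
    linarith
  have hharm : ∀ w, w ≠ q →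
      InnerProductSpace.HarmonicAt (fun z => κ * Real.log (‖z - q‖ / T)) w := fun w hw =>
    (harmonicAt_log_norm_sub_div q hT hw).const_smul (c := κ)
  have hzT : ‖z - q‖ < T / 2 := by simpa [dist_eq_norm] using hz
  have hzU : z ∈ U := by
    refine ⟨?_, ?_⟩
    · rw [Metric.mem_ball, dist_eq_norm]
      linarith
    · simp only [Set.mem_ofPred_eq]
      linarith
  have key := (hφ.mono hUo hUΩ).le_of_frontier hUo
    (Metric.isBounded_ball.subset Set.inter_subset_left)
    (fun w hw => hharm w (hne w (le_of_lt hw.2))) (fun ζ hζ ε hε => ?_) z hzU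
  · refine key.trans (EReal.coe_le_coe_iff.2 ?_)
    have hzq : 0 < ‖z - q‖ := hs.trans_le hzs
    have h1 : Real.log (‖z - q‖ / T) ≤ -Real.log 2 := by
      rw [← Real.log_inv]
      refine Real.log_le_log (by positivity) ?_
      rw [div_le_iff₀ hT]
      linarith
    have h2 : κ * Real.log (‖z - q‖ / T) ≤ κ * (-Real.log 2) := by gcongr
    linarith [min_le_right m (κ * Real.log 2)]
  · rw [hUo.frontier_eq] at hζ
    have hζs : s / 2 ≤ ‖ζ - q‖ :=
      closure_minimal (s := U) (t := {w | s / 2 ≤ ‖w - q‖})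
        (fun w hw => (show s / 2 < ‖w - q‖ from hw.2).le)
        (isClosed_le continuous_const (by fun_prop)) hζ.1
    have hcont := (hharm ζ (hne ζ hζs)).continuousAt
    rcases lt_or_ge ‖ζ - q‖ T with hlt | hge
    · have heq : ‖ζ - q‖ = s / 2 := by
        refine le_antisymm ?_ hζs
        by_contra! h
        exact hζ.2 ⟨by simpa [dist_eq_norm] using hlt, h⟩
      refine eventually_le_add_of_continuousAt (M := -m) hcont ?_ ?_ hε
      · rw [heq, ← inv_div, Real.log_inv, mul_neg, hκ, div_mul_cancel₀ _ hlog.ne']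
      · refine nhdsWithin_le_nhds ?_
        filter_upwards [Metric.isOpen_ball.mem_nhds
          (show ζ ∈ Metric.ball q s by rw [Metric.mem_ball, dist_eq_norm]; linarith)] with w hw
          using hle w hw
    · refine eventually_le_add_of_continuousAt (M := 0) hcont ?_ ?_ hε
      · have : 0 ≤ Real.log (‖ζ - q‖ / T) := Real.log_nonneg ((one_le_div hT).2 hge)
        positivity
      · filter_upwards [self_mem_nhdsWithin] with w hw using (hneg w (hUΩ hw)).le

/-- On a compact subset of a connected open set, the competitors for the Green function are
uniformly negative. -/
theorem exists_le_neg_of_mem_greenFamily {Ω K : Set ℂ} {a : ℂ} (hΩ : IsOpen Ω)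
    (hconn : IsPreconnected Ω) (ha : a ∈ Ω) (hK : IsCompact K) (hKΩ : K ⊆ Ω) :
    ∃ m : ℝ, 0 < m ∧ ∀ ζ ∈ K, ∀ᶠ z in 𝓝 ζ, ∀ φ ∈ greenFamily Ω a, φ z ≤ ((-m : ℝ) : EReal) := by
  -- Connectedness argument: `G` is open, contains a point near the pole, and is relatively closed
  -- in `Ω` because negativity spreads from a small disk to a larger one.
  set G : Set ℂ := {p | ∃ m : ℝ, 0 < m ∧
    ∀ᶠ z in 𝓝 p, ∀ φ ∈ greenFamily Ω a, φ z ≤ ((-m : ℝ) : EReal)} with hG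
  have hGo : IsOpen G := by
    rw [isOpen_iff_mem_nhds]
    rintro p ⟨m, hm, hp⟩
    filter_upwards [hp.eventually_nhds] with w hw using ⟨m, hm, hw⟩
  have hΩG : Ω ⊆ G := by
    refine hconn.subset_of_closure_inter_subset hGo ?_ ?_
    · obtain ⟨ρ, hρ, hρΩ⟩ := Metric.isOpen_iff.1 hΩ a ha
      have hnorm : ‖a + ((ρ / 4 : ℝ) : ℂ) - a‖ = ρ / 4 := by
        rw [add_sub_cancel_left, Complex.norm_real, Real.norm_eq_abs, abs_of_pos (by positivity)]
      have hne : a + ((ρ / 4 : ℝ) : ℂ) ≠ a := by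
        intro h
        rw [h, sub_self, norm_zero] at hnorm
        linarith
      refine ⟨a + ((ρ / 4 : ℝ) : ℂ), hρΩ ?_, 1 / 2 * Real.log 2, by positivity, ?_⟩
      · rw [Metric.mem_ball, dist_eq_norm, hnorm]
        linarith
      filter_upwards [isOpen_ne.mem_nhds hne, Metric.isOpen_ball.mem_nhds
        (show a + ((ρ / 4 : ℝ) : ℂ) ∈ Metric.ball a (ρ / 2) by
          rw [Metric.mem_ball, dist_eq_norm, hnorm]; linarith)] with z hza hz φ hφ
      have hza : z ≠ a := hza
      have hz' : ‖z - a‖ < ρ / 2 := by simpa [dist_eq_norm] using hz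
      refine (le_log_of_mem_greenFamily hφ hρ hρΩ
        (Metric.ball_subset_ball (by linarith) hz) hza).trans (EReal.coe_le_coe_iff.2 ?_)
      have h0 : 0 < ‖z - a‖ := norm_pos_iff.2 (sub_ne_zero.2 hza)
      have h1 : Real.log (‖z - a‖ / ρ) ≤ -Real.log 2 := by
        rw [← Real.log_inv]
        refine Real.log_le_log (by positivity) ?_
        rw [div_le_iff₀ hρ]
        linarith
      linarith
    · rintro p ⟨hpG, hpΩ⟩
      obtain ⟨ρ, hρ, hρΩ⟩ := Metric.isOpen_iff.1 hΩ p hpΩ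
      -- With `T = ρ / 2`, distance less than `ρ / 4` gives both `p ∈ ball q (T / 2)` and `ball q T
      -- ⊆ ball p ρ ⊆ Ω`.
      obtain ⟨q, ⟨m, hm, hq⟩, hqp⟩ := Metric.mem_closure_iff.1 hpG (ρ / 4) (by positivity)
      obtain ⟨σ, hσ, hσq⟩ := Metric.eventually_nhds_iff_ball.1 hq
      set s := min σ (ρ / 4) with hs
      have hs0 : 0 < s := by positivity
      have hsT : s < ρ / 2 := (min_le_right _ _).trans_lt (by linarith)
      have hlog : 0 < Real.log (ρ / 2 / (s / 2)) :=
        Real.log_pos ((one_lt_div (by positivity)).2 (by linarith))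
      refine ⟨min m (m / Real.log (ρ / 2 / (s / 2)) * Real.log 2), by positivity, ?_⟩
      filter_upwards [Metric.isOpen_ball.mem_nhds
        (show p ∈ Metric.ball q (ρ / 2 / 2) by rw [Metric.mem_ball]; linarith)] with z hz φ hφ
      refine hφ.1.le_of_le_on_ball hφ.2.1 hs0 hsT ?_ hm ?_ hz
      · refine (Metric.ball_subset_ball' ?_).trans hρΩ
        rw [dist_comm]
        linarith
      · exact fun w hw => hσq w (Metric.ball_subset_ball (min_le_left _ _) hw) φ hφ
  refine hK.induction_on (p := fun S => ∃ m : ℝ, 0 < m ∧ ∀ ζ ∈ S, ∀ᶠ z in 𝓝 ζ,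
    ∀ φ ∈ greenFamily Ω a, φ z ≤ ((-m : ℝ) : EReal)) ⟨1, one_pos, by simp⟩ ?_ ?_ ?_
  · rintro S S' hSS' ⟨m, hm, H⟩
    exact ⟨m, hm, fun ζ hζ => H ζ (hSS' hζ)⟩
  · rintro S S' ⟨m, hm, H⟩ ⟨m', hm', H'⟩
    refine ⟨min m m', lt_min hm hm', fun ζ hζ => ?_⟩
    rcases hζ with hζ | hζ
    · filter_upwards [H ζ hζ] with z hz φ hφ
      exact (hz φ hφ).trans (EReal.coe_le_coe_iff.2 (neg_le_neg (min_le_left _ _)))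
    · filter_upwards [H' ζ hζ] with z hz φ hφ
      exact (hz φ hφ).trans (EReal.coe_le_coe_iff.2 (neg_le_neg (min_le_right _ _)))
  · intro x hx
    obtain ⟨m, hm, H⟩ := hΩG (hKΩ hx)
    exact ⟨_, mem_nhdsWithin_of_mem_nhds H.eventually_nhds, m, hm, fun ζ hζ => hζ⟩

/-! ### The two estimates in the truncated cusp -/

theorem isPreconnected_planarCusp_inter_ball {C α R : ℝ} (hC : 0 < C) (hα : 0 < α) (hR : 0 < R) :
    IsPreconnected (planarCusp C α ∩ Metric.ball 0 R) := by
  have hsub : Complex.ofReal '' Set.Ioo 0 R ⊆ planarCusp C α ∩ Metric.ball 0 R := by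
    rintro _ ⟨x, hx, rfl⟩
    exact ⟨ofReal_mem_planarCusp hα hx.1, by simpa [abs_of_pos hx.1] using hx.2⟩
  refine isPreconnected_of_forall ((R / 2 : ℝ) : ℂ) fun z hz => ?_
  have hre : 0 < z.re := ((mem_planarCusp_iff hC hα).1 hz.1).1
  have hmem : (z.re : ℂ) ∈ Complex.ofReal '' Set.Ioo 0 R :=
    ⟨z.re, ⟨hre, (Complex.re_le_norm z).trans_lt (by simpa using hz.2)⟩, rfl⟩
  refine ⟨segment ℝ (z.re : ℂ) z ∪ Complex.ofReal '' Set.Ioo 0 R, ?_,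
    Or.inr ⟨R / 2, ⟨by linarith, by linarith⟩, rfl⟩, Or.inl (right_mem_segment _ _ _), ?_⟩
  · refine Set.union_subset (fun w hw => ⟨?_, ?_⟩) hsub
    · obtain ⟨s, s', hs, hs', hss, rfl⟩ := hw
      have h1 : (s • (z.re : ℂ) + s' • z).re = z.re := by
        simp only [Complex.add_re, Complex.real_smul, Complex.re_ofReal_mul, Complex.ofReal_re]
        rw [← add_mul, hss, one_mul]
      have h2 : |(s • (z.re : ℂ) + s' • z).im| ≤ |z.im| := by
        simp only [Complex.add_im, Complex.real_smul, Complex.im_ofReal_mul, Complex.ofReal_im]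
        rw [mul_zero, zero_add, abs_mul, abs_of_nonneg hs']
        exact mul_le_of_le_one_left (abs_nonneg _) (by linarith)
      have h3 : C * |z.im| ^ α < z.re := hz.1
      change C * _ ^ α < _
      rw [h1]
      refine lt_of_le_of_lt ?_ h3
      gcongr
    · exact (convex_ball (0 : ℂ) R).segment_subset (hsub hmem).2 hz.2 hw
  · exact IsPreconnected.union (z.re : ℂ) (left_mem_segment _ _ _) hmem
      (convex_segment _ _).isPreconnected
      (isPreconnected_Ioo.image _ Complex.continuous_ofReal.continuousOn)

/-- Near the vertex, the competitors for the Green function of a truncated cusp lie below a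
multiple of the barrier, uniformly. -/
theorem exists_le_neg_mul_exp_of_mem_greenFamily {C α R : ℝ} (hC : 0 < C) (hα₀ : 0 < α)
    (hα₁ : α < 1) (hR : 0 < R) :
    ∃ m δ : ℝ, 0 < m ∧ 0 < δ ∧
      ∀ φ ∈ greenFamily (planarCusp C α ∩ Metric.ball 0 R) ((R / 2 : ℝ) : ℂ),
        ∀ t : ℝ, 0 < t → t < δ →
          φ t ≤ ((-(m * Real.exp (-(cuspConst C α / t ^ (1 / α - 1)))) : ℝ) : EReal) := by
  set Ω := planarCusp C α ∩ Metric.ball 0 R with hΩdef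
  obtain ⟨b, hbdef⟩ : ∃ b : ℝ, b = 1 / α - 1 := ⟨_, rfl⟩
  have hb : 0 < b := by
    have := (one_lt_div hα₀).2 hα₁
    linarith
  have hb1 : 1 / α = b + 1 := by linarith
  have hAeq : cuspConst C α = Real.pi * C ^ (b + 1) / (2 * b) := by
    rw [cuspConst, ← hbdef, hb1]
  rw [← hbdef]
  obtain ⟨c, δ, hc, hδ, hδR, H⟩ := exists_cuspMap_boundary hC hb hR
  rw [← hAeq] at H
  have hA : 0 < cuspConst C α := by
    rw [hAeq]
    positivity
  generalize cuspConst C α = A at *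
  set F : ℂ → ℝ := fun z => A * |(cuspMap b c z).im| with hF
  have hFc : ∀ z : ℂ, 0 < z.re → ContinuousAt F z := fun z hz =>
    continuousAt_const.mul ((Complex.continuous_im.continuousAt.comp
      (analyticAt_cuspMap b c (Or.inl hz)).continuousAt).abs)
  have hcusp : ∀ z ∈ planarCusp C α, 0 < z.re ∧ |z.im| < (z.re / C) ^ (b + 1) := fun z hz => by
    rw [← hb1]
    exact (mem_planarCusp_iff hC hα₀).1 hz
  set W := planarCusp C α ∩ Metric.ball 0 δ with hW
  have hWo : IsOpen W := (isOpen_planarCusp hα₀).inter Metric.isOpen_ball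
  set U := W ∩ F ⁻¹' Set.Iio (Real.pi / 2) with hU
  have hUo : IsOpen U := ContinuousOn.isOpen_inter_preimage
    (fun z hz => (hFc z (hcusp z hz.1).1).continuousWithinAt) hWo isOpen_Iio
  have hUΩ : U ⊆ Ω := fun z hz => ⟨hz.1.1, Metric.ball_subset_ball hδR.le hz.1.2⟩
  have hUb : Bornology.IsBounded U := Metric.isBounded_ball.subset fun z hz => hz.1.2
  -- Away from the vertex `closure U` avoids the edge of the cusp, since `F > π / 2` on the edge but
  -- `F ≤ π / 2` on the closure. So no boundary regularity of `φ` at the edge is needed.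
  have hcl : ∀ z ∈ closure U, z ≠ 0 → z ∈ planarCusp C α ∧ F z ≤ Real.pi / 2 ∧ ‖z‖ ≤ δ := by
    intro z hz hz0
    have hzδ : ‖z‖ ≤ δ := closure_minimal (s := U) (t := {w | ‖w‖ ≤ δ})
      (fun w hw => by simpa using (Metric.ball_subset_closedBall hw.1.2))
      (isClosed_le continuous_norm continuous_const) hz
    have hle : C * |z.im| ^ α ≤ z.re := closure_minimal (s := U)
      (t := {w | C * |w.im| ^ α ≤ w.re})
      (fun w hw => (show C * |w.im| ^ α < w.re from hw.1.1).le)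
      (isClosed_le (continuous_const.mul ((continuous_abs.comp Complex.continuous_im).rpow_const
        fun _ => Or.inr hα₀.le)) Complex.continuous_re) hz
    have hre : 0 < z.re := by
      refine lt_of_le_of_ne (le_trans (by positivity) hle) fun h0 => hz0 ?_
      have him : z.im = 0 := by
        by_contra him
        have : 0 < C * |z.im| ^ α := by positivity
        linarith
      exact Complex.ext h0.symm him
    have hFz : F z ≤ Real.pi / 2 := le_of_tendsto_of_frequently (hFc z hre)
      ((mem_closure_iff_frequently.1 hz).mono fun w hw => le_of_lt hw.2)
    refine ⟨lt_of_le_of_ne hle fun heq => ?_, hFz, hzδ⟩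
    have him : |z.im| = (z.re / C) ^ (b + 1) := by
      rw [← hb1, ← heq, mul_div_cancel_left₀ _ hC.ne', ← Real.rpow_mul (abs_nonneg _),
        mul_one_div_cancel hα₀.ne', Real.rpow_one]
    exact absurd ((H z hre hzδ him.le).2.2 him) (not_lt.2 hFz)
  obtain ⟨m, hm, hmK⟩ := exists_le_neg_of_mem_greenFamily (Ω := Ω) (a := ((R / 2 : ℝ) : ℂ))
    (K := closure U ∩ Metric.sphere 0 δ) ((isOpen_planarCusp hα₀).inter Metric.isOpen_ball)
    (isPreconnected_planarCusp_inter_ball hC hα₀ hR)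
    ⟨ofReal_mem_planarCusp hα₀ (by positivity), by
      rw [mem_ball_zero_iff, Complex.norm_real, Real.norm_eq_abs, abs_of_pos (by positivity)]
      linarith⟩
    ((isCompact_sphere 0 δ).inter_left isClosed_closure) (fun z hz => by
      have hzδ : ‖z‖ = δ := by simpa using hz.2
      have hz0 : z ≠ 0 := norm_pos_iff.1 (hzδ ▸ hδ)
      exact ⟨(hcl z hz.1 hz0).1, by rw [mem_ball_zero_iff, hzδ]; exact hδR⟩)
  -- Since `b |arg z| ≤ 1`, the real part of `cuspMap` is at least `cos 1` times its radial factor.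
  -- Thus the barrier tends to `0` at the vertex and is at most `1` on the arc.
  have hbar_le : ∀ z ∈ planarCusp C α, ‖z‖ ≤ δ →
      0 ≤ ‖z‖ ^ (-b) - c * ‖z‖ ^ b ∧
      cuspBarrier A b c z ≤
        Real.exp (-(A * ((‖z‖ ^ (-b) - c * ‖z‖ ^ b) * Real.cos 1))) := by
    intro z hz hzδ
    obtain ⟨hre, him⟩ := hcusp z hz
    have hz0 : z ≠ 0 := by rintro rfl; simp at hre
    obtain ⟨h1, h2, -⟩ := H z hre hzδ him.le
    have h3 : Real.cos 1 ≤ Real.cos (b * z.arg) := by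
      rw [← Real.cos_abs (b * z.arg), abs_mul, abs_of_pos hb]
      exact Real.cos_le_cos_of_nonneg_of_le_pi (by positivity)
        (by linarith [Real.pi_gt_three]) h1
    have h4 : 0 ≤ ‖z‖ ^ (-b) - c * ‖z‖ ^ b := sub_nonneg.2 h2
    refine ⟨h4, ?_⟩
    rw [cuspBarrier_eq, cuspMap_re b c hz0]
    refine (mul_le_of_le_one_right (Real.exp_pos _).le (Real.cos_le_one _)).trans ?_
    gcongr
  refine ⟨m, δ, hm, hδ, fun φ hφ t ht htδ => ?_⟩
  have hharm : ∀ z ∈ planarCusp C α,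
      InnerProductSpace.HarmonicAt (fun z => -(m * cuspBarrier A b c z)) z := fun z hz =>
    ((harmonicAt_cuspBarrier A b c (Or.inl (hcusp z hz).1)).const_smul (c := m)).neg
  have hφneg : ∀ ζ, ∀ᶠ z in 𝓝[U] ζ, φ z ≤ ((0 : ℝ) : EReal) := fun ζ => by
    filter_upwards [self_mem_nhdsWithin] with w hw using (hφ.2.1 w (hUΩ hw)).le
  have htU : (t : ℂ) ∈ U := by
    refine ⟨⟨ofReal_mem_planarCusp hα₀ ht, by simpa [abs_of_pos ht] using htδ⟩, ?_⟩
    have h0 : (t : ℂ) ≠ 0 := by exact_mod_cast ht.ne'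
    simp only [hF, Set.mem_preimage, Set.mem_Iio, cuspMap_im b c h0,
      Complex.arg_ofReal_of_nonneg ht.le, mul_zero, Real.sin_zero, neg_zero, abs_zero]
    positivity
  have key := (hφ.1.mono hUo hUΩ).le_of_frontier hUo hUb (fun z hz => hharm z hz.1.1)
    (fun ζ hζ ε hε => ?_) t htU
  · refine key.trans (EReal.coe_le_coe_iff.2 ?_)
    rw [cuspBarrier_ofReal A b c ht, div_eq_mul_inv, ← Real.rpow_neg ht.le]
    have : 0 < t ^ b := Real.rpow_pos_of_pos ht _
    -- On the axis the correction only increases the barrier, so it can be dropped.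
    have h1 : t ^ (-b) - c * t ^ b ≤ t ^ (-b) := by
      have : 0 < c * t ^ b := by positivity
      linarith
    gcongr
  rw [hUo.frontier_eq] at hζ
  by_cases hζ0 : ζ = 0
  · subst hζ0
    have hn : Tendsto (fun z : ℂ => ‖z‖) (𝓝[≠] 0) (𝓝[>] 0) := tendsto_norm_nhdsNE_zero
    have hpow : Tendsto (fun z : ℂ => ‖z‖ ^ (-b)) (𝓝[≠] 0) atTop :=
      (tendsto_rpow_neg_nhdsGT_zero (neg_neg_of_pos hb)).comp hn
    have hpow' : Tendsto (fun z : ℂ => ‖z‖ ^ b) (𝓝[≠] 0) (𝓝 0) := by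
      have := (Real.continuous_rpow_const hb.le).tendsto 0
      rw [Real.zero_rpow hb.ne'] at this
      exact (this.mono_left nhdsWithin_le_nhds).comp hn
    have hcos : 0 < Real.cos 1 := Real.cos_one_pos
    have hlim : Tendsto (fun z : ℂ => m * Real.exp (-(A * ((‖z‖ ^ (-b) - c * ‖z‖ ^ b) *
        Real.cos 1)))) (𝓝[≠] 0) (𝓝 (m * 0)) := by
      refine (Real.tendsto_exp_neg_atTop_nhds_zero.comp ?_).const_mul m
      refine Tendsto.const_mul_atTop hA (Tendsto.atTop_mul_const hcos ?_)
      simpa only [sub_eq_add_neg] using hpow.atTop_add (hpow'.const_mul c).neg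
    rw [mul_zero] at hlim
    have hev := (hlim.eventually_lt_const hε).filter_mono (nhdsWithin_mono 0
      (show U ⊆ {0}ᶜ by
        rintro z hz rfl
        have := (hcusp 0 hz.1.1).1
        simp at this))
    filter_upwards [hev, hφneg 0, self_mem_nhdsWithin] with z hz1 hz2 hzU
    refine hz2.trans (EReal.coe_le_coe_iff.2 ?_)
    have h1 := (hbar_le z hzU.1.1 (by simpa using (Metric.ball_subset_closedBall hzU.1.2))).2
    have h2 := mul_le_mul_of_nonneg_left h1 hm.le
    linarith
  · obtain ⟨hζc, hFζ, hζδ⟩ := hcl ζ hζ.1 hζ0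
    have hcont := (hharm ζ hζc).continuousAt
    rcases lt_or_eq_of_le hζδ with hlt | heq
    · refine eventually_le_add_of_continuousAt (M := 0) hcont ?_ (hφneg ζ) hε
      have hFeq : F ζ = Real.pi / 2 := by
        refine le_antisymm hFζ ?_
        by_contra! h
        exact hζ.2 ⟨⟨hζc, by simpa using hlt⟩, h⟩
      have hcos0 : Real.cos (A * (cuspMap b c ζ).im) = 0 := by
        rw [← Real.cos_abs, abs_mul, abs_of_pos hA, ← Real.cos_pi_div_two]
        exact congrArg Real.cos hFeq
      rw [cuspBarrier_eq, hcos0]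
      simp
    · refine eventually_le_add_of_continuousAt (M := -m) hcont ?_ ?_ hε
      · obtain ⟨h1, h2⟩ := hbar_le ζ hζc hζδ
        have h3 : cuspBarrier A b c ζ ≤ 1 := h2.trans (Real.exp_le_one_iff.2 (by
          have := Real.cos_one_pos
          have : 0 ≤ A * ((‖ζ‖ ^ (-b) - c * ‖ζ‖ ^ b) * Real.cos 1) := by positivity
          linarith))
        have := mul_le_mul_of_nonneg_left h3 hm.le
        linarith
      · exact nhdsWithin_le_nhds
          ((hmK ζ ⟨hζ.1, by simpa using heq⟩).mono fun z hz => hz φ hφ)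

/-- The uncorrected map `z^(-b)` suffices here, as positivity of the barrier is all that the glued
competitor requires. The condition `t < R / 4` keeps `t` at distance at least `R / 4` from the pole.
-/
theorem exists_neg_mul_exp_le_greenFunction {C α R : ℝ} (hC : 0 < C) (hα₀ : 0 < α)
    (hα₁ : α < 1) (hR : 0 < R) :
    ∃ c : ℝ, 0 < c ∧ ∀ t : ℝ, 0 < t → t < R / 4 →
      ((-(c * Real.exp (-(cuspConst C α / t ^ (1 / α - 1)))) : ℝ) : EReal) ≤
        greenFunction (planarCusp C α ∩ Metric.ball 0 R) (t : ℂ) ((R / 2 : ℝ) : ℂ) := by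
  obtain ⟨b, hbdef⟩ : ∃ b : ℝ, b = 1 / α - 1 := ⟨_, rfl⟩
  have hb : 0 < b := by
    have := (one_lt_div hα₀).2 hα₁
    linarith
  have hb1 : 1 / α = b + 1 := by linarith
  have hAeq : cuspConst C α = Real.pi * C ^ (b + 1) / (2 * b) := by
    rw [cuspConst, ← hbdef, hb1]
  have hcusp : ∀ z ∈ planarCusp C α, 0 < z.re ∧ |z.im| < (z.re / C) ^ (b + 1) := fun z hz => by
    rw [← hb1]
    exact (mem_planarCusp_iff hC hα₀).1 hz
  have hreal : ∀ x : ℝ, 0 < x → x < R → (x : ℂ) ∈ planarCusp C α ∩ Metric.ball 0 R :=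
    fun x hx hxR => ⟨ofReal_mem_planarCusp hα₀ hx, by simpa [abs_of_pos hx] using hxR⟩
  obtain ⟨c, hc, H⟩ := exists_neg_mul_le_greenFunction (a := ((R / 2 : ℝ) : ℂ)) (T := 2 * R)
    (h := cuspBarrier (cuspConst C α) b 0) (ε := R / 4)
    ((isOpen_planarCusp hα₀).inter Metric.isOpen_ball)
    (hreal (R / 2) (by linarith) (by linarith))
    (fun z hz => by
      have h1 : ‖z‖ < R := by simpa using hz.2
      have h2 := norm_sub_le z ((R / 2 : ℝ) : ℂ)
      rw [Complex.norm_real, Real.norm_eq_abs, abs_of_pos (by linarith : 0 < R / 2)] at h2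
      linarith)
    (fun z hz => harmonicAt_cuspBarrier _ _ _ (Or.inl (hcusp z hz.1).1))
    (fun z hz => hAeq ▸ cuspBarrier_zero_pos hC hb (hcusp z hz.1).1 (hcusp z hz.1).2)
    (by linarith)
  refine ⟨c, hc, fun t ht htR => ?_⟩
  have h1 := H t (hreal t ht (by linarith)) (by
    rw [← Complex.ofReal_sub, Complex.norm_real, Real.norm_eq_abs, abs_sub_comm]
    exact le_trans (by linarith) (le_abs_self _))
  rw [cuspBarrier_ofReal _ _ _ ht, zero_mul, sub_zero, Real.rpow_neg ht.le, ← div_eq_mul_inv] at h1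
  rwa [← hbdef]

/-- Two-sided estimate, along the axis near the vertex, of the Green function with pole `R/2` of
the intersection of a planar cusp with the disk of radius `R` about the vertex. -/
theorem theorem1p2 (C α R : ℝ) (hC : 0 < C) (hα₀ : 0 < α) (hα₁ : α < 1) (hR : 0 < R) :
    ∃ c₁ c₂ t₀ : ℝ, 0 < c₁ ∧ 0 < c₂ ∧ 0 < t₀ ∧ ∀ t : ℝ, 0 < t → t < t₀ →
      ((-(c₂ * Real.exp (-(cuspConst C α / t ^ (1 / α - 1)))) : ℝ) : EReal) ≤
          greenFunction (planarCusp C α ∩ Metric.ball 0 R) (t : ℂ) ((R / 2 : ℝ) : ℂ) ∧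
        greenFunction (planarCusp C α ∩ Metric.ball 0 R) (t : ℂ) ((R / 2 : ℝ) : ℂ) ≤
          ((-(c₁ * Real.exp (-(cuspConst C α / t ^ (1 / α - 1)))) : ℝ) : EReal) := by
  obtain ⟨m, δ, hm, hδ, hupper⟩ := exists_le_neg_mul_exp_of_mem_greenFamily hC hα₀ hα₁ hR
  obtain ⟨c, hc, hlower⟩ := exists_neg_mul_exp_le_greenFunction hC hα₀ hα₁ hR
  refine ⟨m, c, min δ (R / 4), hm, hc, by positivity, fun t ht htlt => ⟨?_, ?_⟩⟩
  · exact hlower t ht (htlt.trans_le (min_le_right _ _))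
  · exact iSup₂_le fun φ hφ => hupper φ hφ t ht (htlt.trans_le (min_le_left _ _))
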